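/- Fix a real number $\ell<1$ and let $\Gamma$ be the two-player coordination game in which each player has the actions $\mathsf A,\mathsf B$, both players get utility $1$ if their actions agree, and both get $\ell$ otherwise (for example $\ell=-1$, or $\ell=0$ for utilities in $[0,1]$). The mediator's objective is $u_0=-(u_1+u_2)$, i.e. to minimize welfare. An optimal equilibrium is a (mixed) Nash equilibrium of $\Gamma$ that maximizes the expected $u_0$ among all Nash equilibria. *Steering without advice.* A mediator, at horizon $T$ and in each round $t$, offers payment functions $p_i^{(t)}:X_1\times X_2\to[0,P_T]$ on the mixed profiles, linear in $x_i$ and continuous in $x_{-i}$, that may depend on $T$ and on the earlier strategy profiles; then the players choose a mixed profile $x^{(t)}$, and player $i$ gets $v_i^{(t)}(x^{(t)})$, where $v_i^{(t)}=u_i+p_i^{(t)}$. Player $i$'s regret after $s$ rounds is $\frac1{P_T+1}\bigl[\max_{y}\sum_{t\le s}v_i^{(t)}(y,x_{-i}^{(t)})-\sum_{t\le s}v_i^{(t)}(x^{(t)})\bigr]$. Given $R:\mathbb N\to\mathbb R$, the mediator steers the players to $d$ if, for all plays (one for each horizon $T$) in which every player's regret is at most $R(s)$ after each $s\le T$ rounds,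 as $T\to\infty$ both the largest time-averaged realized payment $\max_i\frac1T\sum_{t\le T}p_i^{(t)}(x^{(t)})$ and the $\ell^1$-distance between the time-averaged outcome distribution of $x^{(1)},\dots,x^{(T)}$ and the outcome distribution of $d$ tend to $0$. **Theorem.** $\Gamma$ has exactly one optimal equilibrium $d$; it is the fully mixed profile in which both players play $\mathsf A$ and $\mathsf B$ with probability $1/2$ each. Moreover: 1. (Payments at outcomes.) Suppose $p_i(x)=\mathbb E_{z\sim x}\,q_i(z)$ for some $q_i\ge 0$ on the pure action profiles. Then the game with utilities $u_i+p_i$ has a Nash equilibrium that is pure if a pure one exists, and every such equilibrium $x$ satisfies $\sum_{i}\bigl(u_i(x)+2p_i(x)\bigr)>1$. For every $R\ge0$ (including $R=0$), no mediator all of whose payment functions are of this form steers the players to $d$. 2. (Arbitrary payment functions.) There is a constant $C$, depending only on $\ell$, such that the following hold. (a) There is a deterministic players' algorithm, choosing $x^{(t)}$ from the payment functions of the rounds up to and including $t$ only, such that for every $P$ and every sequence of payment functions with values in $[0,P]$ as above, each player's regret (normalized by $\frac1{P+1}$) after $T$ rounds is at most $C\sqrt T$ for every $T$, and $\sum_i\bigl(u_i(x^{(t)})+2p_i^{(t)}(x^{(t)})\bigr)>1$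 for every round $t$. (b) For every $R$ with $R(T)\ge C\sqrt T$ for all $T$, no mediator without advice steers the players to $d$. -/

import Mathlib

open Filter Topology

noncomputable section

namespace Steering

/-- A finite normal-form game with player set `ι` and action sets `A i`. -/
structure NormalFormGame (ι : Type) (A : ι → Type) where
  utility : ι → ((i : ι) → A i) → ℝ

/-- Profiles of (independent) mixed strategies. -/
abbrev MixedProfile (ι : Type) (A : ι → Type) [∀ i, Fintype (A i)] : Type :=
  (i : ι) → stdSimplex ℝ (A i)

/-- A payment function for every player, defined on all mixed profiles. -/
abbrev Payment (ι : Type) (A : ι → Type) [∀ i, Fintype (A i)] : Type :=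
  ι → MixedProfile ι A → ℝ

section General

variable {ι : Type} {A : ι → Type} [Fintype ι] [DecidableEq ι]
  [∀ i, Fintype (A i)] [∀ i, DecidableEq (A i)]

/-- The probability of the outcome (terminal node) `z` under the mixed profile `x`. -/
def outcomeProb (x : MixedProfile ι A) (z : (i : ι) → A i) : ℝ :=
  ∏ i, x i (z i)

/-- The expectation of a function of the outcome under the mixed profile `x`. -/
def expect (f : ((i : ι) → A i) → ℝ) (x : MixedProfile ι A) : ℝ :=
  ∑ z, outcomeProb x z * f z

/-- The pure profile `z`, seen as a mixed profile. -/
def pureProfile (z : (i : ι) → A i) : MixedProfile ι A :=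
  fun i => stdSimplex.vertex (z i)

def IsPure (x : MixedProfile ι A) : Prop :=
  ∃ z, x = pureProfile z

/-- `x` is a Nash equilibrium of the game in which player `i` gets `v i x`. -/
def IsNash (v : ι → MixedProfile ι A → ℝ) (x : MixedProfile ι A) : Prop :=
  ∀ (i : ι) (y : stdSimplex ℝ (A i)), v i (Function.update x i y) ≤ v i x

/-- Expected utility of player `i` in `Γ`. -/
def NormalFormGame.expUtility (Γ : NormalFormGame ι A) (i : ι) (x : MixedProfile ι A) : ℝ :=
  expect (Γ.utility i) x

/-- Expected utility of player `i` in the payment-augmented game. -/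
def NormalFormGame.augUtility (Γ : NormalFormGame ι A) (p : Payment ι A) (i : ι)
    (x : MixedProfile ι A) : ℝ :=
  Γ.expUtility i x + p i x

/-- `x` is a Nash equilibrium of `Γ` that, among all Nash equilibria of `Γ`, maximizes the
mediator's expected objective `u₀`. -/
def NormalFormGame.IsOptimalEquilibrium (Γ : NormalFormGame ι A)
    (u₀ : ((i : ι) → A i) → ℝ) (x : MixedProfile ι A) : Prop :=
  IsNash Γ.expUtility x ∧ ∀ y, IsNash Γ.expUtility y → expect u₀ y ≤ expect u₀ x

/-- The payment functions allowed to the mediator: values in `[0, P]`, linear in the player's own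
strategy, continuous in the strategies of the others. -/
structure IsPayment (P : ℝ) (p : Payment ι A) : Prop where
  mem_Icc : ∀ i x, p i x ∈ Set.Icc 0 P
  linear_own : ∀ i x,
    p i x = ∑ a, x i a * p i (Function.update x i (stdSimplex.vertex a))
  continuous_others : ∀ i (y : stdSimplex ℝ (A i)),
    Continuous fun x : MixedProfile ι A => p i (Function.update x i y)

/-- The expected payments of a scheme that pays `q i z` to player `i` at the realized outcome `z`. -/
def outcomePayment (q : ι → ((i : ι) → A i) → ℝ) : Payment ι A :=
  fun i x => expect (q i) x

/-- The regret of player `i` after rounds `0, …, T - 1`, when the payment functions are `p t`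
(with values in `[0, P]`) and the strategy profiles are `x t`, normalized by `1 / (P + 1)`. -/
def NormalFormGame.regret (Γ : NormalFormGame ι A) (P : ℝ) (p : ℕ → Payment ι A)
    (x : ℕ → MixedProfile ι A) (i : ι) (T : ℕ) : ℝ :=
  1 / (P + 1) *
    ((⨆ y : stdSimplex ℝ (A i),
        ∑ t ∈ Finset.range T, Γ.augUtility (p t) i (Function.update (x t) i y))
      - ∑ t ∈ Finset.range T, Γ.augUtility (p t) i (x t))

/-- The largest (over the players) time-averaged realized payment in the first `T` rounds. -/
def averagePayment (p : ℕ → Payment ι A) (x : ℕ → MixedProfile ι A) (T : ℕ) : ℝ :=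
  ⨆ i, 1 / (T : ℝ) * ∑ t ∈ Finset.range T, p t i (x t)

/-- The `ℓ¹` distance between the time-averaged outcome distribution in the first `T` rounds and
the outcome distribution of the target profile `d`. -/
def directnessGap (d : MixedProfile ι A) (x : ℕ → MixedProfile ι A) (T : ℕ) : ℝ :=
  ∑ z, |(1 / (T : ℝ) * ∑ t ∈ Finset.range T, outcomeProb (x t) z) - outcomeProb d z|

/-- A mediator without advice. When the horizon is `T`, it offers in round `t` the payment
functions `pay T t h`, where `h` lists the strategy profiles of the earlier rounds; the
per-round bound `bound T` may depend on the horizon. -/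
structure Mediator (ι : Type) (A : ι → Type) [Fintype ι] [DecidableEq ι]
    [∀ i, Fintype (A i)] [∀ i, DecidableEq (A i)] where
  bound : ℕ → ℝ
  pay : (T t : ℕ) → (Fin t → MixedProfile ι A) → Payment ι A
  isPayment : ∀ T t h, IsPayment (bound T) (pay T t h)

/-- The payment functions that the mediator offers over time, at horizon `T`, against the play
`x`. -/
def Mediator.offered (M : Mediator ι A) (T : ℕ) (x : ℕ → MixedProfile ι A) (t : ℕ) :
    Payment ι A :=
  M.pay T t fun s => x s

/-- All payments of the mediator are induced by payments at the realized outcomes. -/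
def Mediator.IsOutcomeBased (M : Mediator ι A) : Prop :=
  ∀ T t h, ∃ q : ι → ((i : ι) → A i) → ℝ, M.pay T t h = outcomePayment q

/-- The mediator steers all players whose regret is bounded by `R` to the profile `d`: for every
family of plays `x T`, one for each horizon `T`, in which at all times up to the horizon each
player's regret is bounded by `R`, the average payments and the directness gap tend to `0` as the
horizon grows. -/
def Mediator.Steers (M : Mediator ι A) (Γ : NormalFormGame ι A) (R : ℕ → ℝ)
    (d : MixedProfile ι A) : Prop :=
  ∀ x : ℕ → ℕ → MixedProfile ι A,
    (∀ T, ∀ s ≤ T, ∀ i, Γ.regret (M.bound T) (M.offered T (x T)) (x T) i s ≤ R s) →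
      Tendsto (fun T => averagePayment (M.offered T (x T)) (x T) T) atTop (𝓝 0) ∧
      Tendsto (fun T => directnessGap d (x T) T) atTop (𝓝 0)

/-- A deterministic algorithm that picks the profile of round `t` from the payment functions of
rounds `0, …, t`. -/
abbrev PlayerAlgorithm (ι : Type) (A : ι → Type) [∀ i, Fintype (A i)] : Type :=
  (t : ℕ) → (Fin (t + 1) → Payment ι A) → MixedProfile ι A

/-- The play that a players' algorithm produces against a sequence of payment functions. -/
def PlayerAlgorithm.play (alg : PlayerAlgorithm ι A) (p : ℕ → Payment ι A) (t : ℕ) :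
    MixedProfile ι A :=
  alg t fun s => p s

end General

/-- The 2-player, 2-action coordination game: both players get `1` if their actions agree, and
both get `lo` otherwise. -/
def coordinationGame (lo : ℝ) : NormalFormGame (Fin 2) (fun _ => Fin 2) where
  utility := fun _ z => if z 0 = z 1 then 1 else lo

/-- The objective of a mediator who wants to minimize the players' welfare. -/
def welfareMinObjective (lo : ℝ) (z : Fin 2 → Fin 2) : ℝ :=
  -∑ i, (coordinationGame lo).utility i z

end Steering

end

open Filter Topology

noncomputable section

namespace Steering

/-! The obstruction is the inequality ∑ (u_i + 2 p_i) ≥ 2. If it holds in every round while average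
payments and directness gap vanish, then the limiting welfare is at least 2; but the uniform profile
has welfare 1 + ℓ < 2 (`not_tendsto_of_welfare_bound`). So it suffices to find low-regret play that
satisfies it.

The inequality comes from a dichotomy (`exists_pure_isNash_or_mismatches`). At a pure equilibrium of
the augmented game, either the actions agree and welfare alone is 2, or each player must be paid at
least 1 - ℓ not to copy the other. Without a pure equilibrium, some player strictly prefers to
mismatch each pure action of the opponent, so is paid at least 1 - ℓ at every pure disagreement.
Against a pure opponent, own-linearity turns this into (1 - ℓ) times the probability of
disagreement; the factor 2 then covers the loss of both players.

For payments at outcomes, linearity in the opponent's strategy extends the bound to mixed opponents,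
so exact equilibrium play, with no positive regret, defeats the mediator. For general payments,
`exists_response` finds a profile that satisfies the inequality and in which each player does at
least as well as a prescribed reference strategy. With regret-matching strategies as references, the
usual potential argument gives regret of order √T. -/

/-- A family of functions in which the `i`-th is linear in the strategy of player `i`. -/
def OwnLinear {ι : Type} {A : ι → Type} [DecidableEq ι] [∀ i, Fintype (A i)]
    [∀ i, DecidableEq (A i)] (v : ι → MixedProfile ι A → ℝ) : Prop :=
  ∀ i x y, v i (Function.update x i y) =
    ∑ a, y a * v i (Function.update x i (stdSimplex.vertex a))

section General

variable {ι : Type} {A : ι → Type} [DecidableEq ι]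
  [∀ i, Fintype (A i)] [∀ i, DecidableEq (A i)]

theorem OwnLinear.apply {v : ι → MixedProfile ι A → ℝ} (hv : OwnLinear v) (i : ι)
    (x : MixedProfile ι A) :
    v i x = ∑ a, x i a * v i (Function.update x i (stdSimplex.vertex a)) := by
  simpa using hv i x (x i)

theorem OwnLinear.add {v w : ι → MixedProfile ι A → ℝ} (hv : OwnLinear v) (hw : OwnLinear w) :
    OwnLinear fun i x => v i x + w i x := by
  intro i x y
  simp only [hv i x y, hw i x y, mul_add, Finset.sum_add_distrib]

theorem IsPayment.ownLinear {P : ℝ} {p : Payment ι A} (hp : IsPayment P p) : OwnLinear p := by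
  intro i x y
  simpa using hp.linear_own i (Function.update x i y)

/-- A deviation is unprofitable if all pure deviations are. -/
theorem OwnLinear.le_of_forall_vertex {v : ι → MixedProfile ι A → ℝ} (hv : OwnLinear v) {i : ι}
    {x : MixedProfile ι A} {c : ℝ}
    (h : ∀ a, v i (Function.update x i (stdSimplex.vertex a)) ≤ c) (y : stdSimplex ℝ (A i)) :
    v i (Function.update x i y) ≤ c := by
  rw [hv i x y]
  calc ∑ a, y a * v i (Function.update x i (stdSimplex.vertex a)) ≤ ∑ a, y a * c :=
        Finset.sum_le_sum fun a _ => mul_le_mul_of_nonneg_left (h a) (y.2.1 a)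
    _ = c := by rw [← Finset.sum_mul, show ∑ a, y a = 1 from y.2.2, one_mul]

theorem OwnLinear.isNash_iff {v : ι → MixedProfile ι A → ℝ} (hv : OwnLinear v)
    (x : MixedProfile ι A) :
    IsNash v x ↔ ∀ i a, v i (Function.update x i (stdSimplex.vertex a)) ≤ v i x :=
  ⟨fun h i _ => h i _, fun h i y => hv.le_of_forall_vertex (h i) y⟩

theorem IsPayment.bound_nonneg [Nonempty ι] [Nonempty (MixedProfile ι A)] {P : ℝ}
    {p : Payment ι A} (hp : IsPayment P p) : 0 ≤ P :=
  let ⟨x⟩ := ‹Nonempty (MixedProfile ι A)›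
  let ⟨i⟩ := ‹Nonempty ι›
  (hp.mem_Icc i x).1.trans (hp.mem_Icc i x).2

end General

/-! ### Two-by-two games in coordinates -/

/-- The profile of two players with two actions each, given by its two strategies. -/
def pair (a b : stdSimplex ℝ (Fin 2)) : MixedProfile (Fin 2) fun _ => Fin 2 := ![a, b]

@[simp] theorem pair_zero (a b : stdSimplex ℝ (Fin 2)) : pair a b 0 = a := rfl

@[simp] theorem pair_one (a b : stdSimplex ℝ (Fin 2)) : pair a b 1 = b := rfl

@[simp] theorem update_pair_zero (a b c : stdSimplex ℝ (Fin 2)) :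
    Function.update (pair a b) 0 c = pair c b := by
  ext i : 1; fin_cases i <;> simp

@[simp] theorem update_pair_one (a b c : stdSimplex ℝ (Fin 2)) :
    Function.update (pair a b) 1 c = pair a c := by
  ext i : 1; fin_cases i <;> simp

theorem eq_pair (x : MixedProfile (Fin 2) fun _ => Fin 2) : x = pair (x 0) (x 1) := by
  ext i : 1; fin_cases i <;> rfl

/-- The pure strategy that plays `a`. -/
abbrev pureStrategy (a : Fin 2) : stdSimplex ℝ (Fin 2) := stdSimplex.vertex a

theorem pureProfile_eq_pair (z : Fin 2 → Fin 2) :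
    (pureProfile z : MixedProfile (Fin 2) fun _ => Fin 2) =
      pair (pureStrategy (z 0)) (pureStrategy (z 1)) := by
  ext i : 1; fin_cases i <;> rfl

theorem isPure_pair (a b : Fin 2) : IsPure (pair (pureStrategy a) (pureStrategy b)) :=
  ⟨![a, b], by rw [pureProfile_eq_pair]; rfl⟩

theorem strategy_nonneg (a : stdSimplex ℝ (Fin 2)) (i : Fin 2) : 0 ≤ a i := a.2.1 i

theorem strategy_sum (a : stdSimplex ℝ (Fin 2)) : a 0 + a 1 = 1 := by
  have := a.2.2
  rwa [Fin.sum_univ_two] at this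

theorem strategy_ext {a b : stdSimplex ℝ (Fin 2)} (h : a 0 = b 0) : a = b := by
  have ha := strategy_sum a
  have hb := strategy_sum b
  ext i
  fin_cases i
  · exact h
  · change a 1 = b 1
    linarith

theorem pureStrategy_apply (a b : Fin 2) : pureStrategy a b = if a = b then 1 else 0 := by
  change (Pi.single a 1 : Fin 2 → ℝ) b = _
  rw [Pi.single_apply]
  simp only [eq_comm]

theorem expect_eq (f : (Fin 2 → Fin 2) → ℝ) (x : MixedProfile (Fin 2) fun _ => Fin 2) :
    expect f x = x 0 0 * x 1 0 * f ![0, 0] + x 0 0 * x 1 1 * f ![0, 1]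
      + x 0 1 * x 1 0 * f ![1, 0] + x 0 1 * x 1 1 * f ![1, 1] := by
  unfold expect outcomeProb
  rw [← (piFinTwoEquiv fun _ => Fin 2).symm.sum_comp, Fintype.sum_prod_type]
  have h (a b : Fin 2) : (piFinTwoEquiv fun _ => Fin 2).symm (a, b) = ![a, b] := by
    ext i; fin_cases i <;> rfl
  simp [h, Fin.sum_univ_two, add_assoc]

theorem ownLinear_expect (q : Fin 2 → (Fin 2 → Fin 2) → ℝ) :
    OwnLinear fun i (x : MixedProfile (Fin 2) fun _ => Fin 2) => expect (q i) x := by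
  intro i x y
  rw [eq_pair x]
  fin_cases i <;> simp [expect_eq, Fin.sum_univ_two, pureStrategy_apply] <;> ring

theorem expUtility_eq (lo : ℝ) (i : Fin 2) (x : MixedProfile (Fin 2) fun _ => Fin 2) :
    (coordinationGame lo).expUtility i x =
      lo + (1 - lo) * (x 0 0 * x 1 0 + x 0 1 * x 1 1) := by
  have h0 : x 0 1 = 1 - x 0 0 := by linarith [strategy_sum (x 0)]
  have h1 : x 1 1 = 1 - x 1 0 := by linarith [strategy_sum (x 1)]
  simp [NormalFormGame.expUtility, expect_eq, coordinationGame, h0, h1]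
  ring

theorem agreement_mem_Icc (x : MixedProfile (Fin 2) fun _ => Fin 2) :
    x 0 0 * x 1 0 + x 0 1 * x 1 1 ∈ Set.Icc (0 : ℝ) 1 := by
  have h0 := strategy_sum (x 0)
  have h1 := strategy_sum (x 1)
  have a0 := strategy_nonneg (x 0) 0
  have a1 := strategy_nonneg (x 0) 1
  have b0 := strategy_nonneg (x 1) 0
  have b1 := strategy_nonneg (x 1) 1
  constructor
  · positivity
  · nlinarith [mul_nonneg a0 b1, mul_nonneg a1 b0]

theorem expUtility_mem_Icc {lo : ℝ} (hlo : lo < 1) (i : Fin 2)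
    (x : MixedProfile (Fin 2) fun _ => Fin 2) :
    (coordinationGame lo).expUtility i x ∈ Set.Icc lo 1 := by
  have h := agreement_mem_Icc x
  rw [expUtility_eq]
  constructor
  · nlinarith [h.1]
  · nlinarith [h.2]

theorem ownLinear_augUtility (lo : ℝ) {p : Payment (Fin 2) fun _ => Fin 2} (hp : OwnLinear p) :
    OwnLinear ((coordinationGame lo).augUtility p) :=
  (ownLinear_expect _).add hp

/-- The strategy that plays action `0` with probability `c`. -/
def strategyOf (c : ℝ) (h0 : 0 ≤ c) (h1 : c ≤ 1) : stdSimplex ℝ (Fin 2) :=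
  ⟨![c, 1 - c], fun i => by fin_cases i <;> simp [h0, h1], by simp⟩

@[simp] theorem strategyOf_zero (c : ℝ) (h0 : 0 ≤ c) (h1 : c ≤ 1) : strategyOf c h0 h1 0 = c := rfl

@[simp] theorem strategyOf_one (c : ℝ) (h0 : 0 ≤ c) (h1 : c ≤ 1) :
    strategyOf c h0 h1 1 = 1 - c := rfl

/-! ### The unique optimal equilibrium -/

/-- The profile in which both players play both actions with probability `1 / 2`. -/
def uniformProfile : MixedProfile (Fin 2) fun _ => Fin 2 :=
  pair (strategyOf (1 / 2) (by norm_num) (by norm_num))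
    (strategyOf (1 / 2) (by norm_num) (by norm_num))

theorem uniformProfile_apply (i a : Fin 2) : uniformProfile i a = 1 / 2 := by
  fin_cases i <;> fin_cases a <;> simp [uniformProfile] <;> norm_num

theorem not_isPure_uniformProfile : ¬ IsPure uniformProfile := by
  rintro ⟨z, hz⟩
  have h := uniformProfile_apply 0 (z 0)
  rw [hz, pureProfile_eq_pair, pair_zero, pureStrategy_apply, if_pos rfl] at h
  norm_num at h

theorem eq_uniformProfile {x : MixedProfile (Fin 2) fun _ => Fin 2} (h0 : x 0 0 = 1 / 2)
    (h1 : x 1 0 = 1 / 2) : x = uniformProfile := by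
  rw [eq_pair x, uniformProfile]
  congr 1
  · exact strategy_ext h0
  · exact strategy_ext h1

theorem isNash_uniformProfile (lo : ℝ) :
    IsNash (coordinationGame lo).expUtility uniformProfile := by
  intro i y
  have := strategy_sum y
  fin_cases i <;> simp [uniformProfile, expUtility_eq] <;>
    linear_combination (1 - lo) / 2 * this

/-- In a Nash equilibrium other than the uniform one, the players agree with certainty. -/
theorem agreement_of_isNash {lo : ℝ} (hlo : lo < 1) {x : MixedProfile (Fin 2) fun _ => Fin 2}
    (hx : IsNash (coordinationGame lo).expUtility x) :
    x = uniformProfile ∨ x 0 0 * x 1 0 + x 0 1 * x 1 1 = 1 := by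
  have hd : 0 < 1 - lo := by linarith
  obtain ⟨a, b, rfl⟩ : ∃ a b, x = pair a b := ⟨_, _, eq_pair x⟩
  have sa := strategy_sum a
  have sb := strategy_sum b
  -- Both utilities are the same increasing affine function of the agreement probability, so the
  -- equilibrium conditions compare agreement probabilities only.
  have h0 (c : Fin 2) := hx 0 (pureStrategy c)
  have h1 (c : Fin 2) := hx 1 (pureStrategy c)
  simp only [update_pair_zero, update_pair_one, expUtility_eq, add_le_add_iff_left,
    mul_le_mul_iff_right₀ hd, pair_zero, pair_one] at h0 h1
  have h00 := h0 0
  have h01 := h0 1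
  have h10 := h1 0
  have h11 := h1 1
  simp [pureStrategy_apply] at h00 h01 h10 h11
  have ea : a 1 = 1 - a 0 := by linarith
  have eb : b 1 = 1 - b 0 := by linarith
  simp only [pair_zero, pair_one]
  have a0 := strategy_nonneg a 0
  have a1 := strategy_nonneg a 1
  rw [ea] at a1 h00 h01 h10 h11
  rw [eb] at h00 h01 h10 h11
  rw [ea, eb]
  rcases lt_trichotomy (b 0) (1 / 2) with h | h | h
  · have : a 0 = 0 := by nlinarith
    right
    rw [this] at h10 h11 ⊢
    linarith [strategy_nonneg b 0, strategy_nonneg b 1]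
  -- Player 1 uses both actions, hence is indifferent between them, which forces player 0 to be
  -- uniform.
  · left
    refine eq_uniformProfile ?_ h
    simp only [pair_zero]
    rw [h] at h10 h11
    linarith
  · have : a 0 = 1 := by nlinarith
    right
    rw [this] at h10 h11 ⊢
    linarith [strategy_nonneg b 0, strategy_nonneg b 1]

theorem expect_welfareMinObjective (lo : ℝ) (x : MixedProfile (Fin 2) fun _ => Fin 2) :
    expect (welfareMinObjective lo) x =
      -2 * (lo + (1 - lo) * (x 0 0 * x 1 0 + x 0 1 * x 1 1)) := by
  rw [← expUtility_eq lo 0, NormalFormGame.expUtility, expect_eq, expect_eq]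
  simp [welfareMinObjective, coordinationGame]
  ring

theorem isOptimalEquilibrium_iff {lo : ℝ} (hlo : lo < 1)
    (x : MixedProfile (Fin 2) fun _ => Fin 2) :
    (coordinationGame lo).IsOptimalEquilibrium (welfareMinObjective lo) x ↔
      x = uniformProfile := by
  constructor
  · rintro ⟨hx, hopt⟩
    refine (agreement_of_isNash hlo hx).resolve_right fun h => ?_
    have := hopt _ (isNash_uniformProfile lo)
    simp only [expect_welfareMinObjective, h, uniformProfile_apply] at this
    linarith
  · rintro rfl
    refine ⟨isNash_uniformProfile lo, fun y hy => ?_⟩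
    rcases agreement_of_isNash hlo hy with rfl | h
    · exact le_rfl
    · simp only [expect_welfareMinObjective, h, uniformProfile_apply]
      linarith

/-! ### Payments that compensate for disagreement -/

/-- In a pure equilibrium of the augmented game, the payments make up for the welfare lost to
disagreement. -/
theorem welfare_bound_of_isNash_pure {lo : ℝ} (hlo : lo < 1)
    {p : Payment (Fin 2) fun _ => Fin 2} (hnn : ∀ i x, 0 ≤ p i x) (a b : Fin 2)
    (hx : IsNash ((coordinationGame lo).augUtility p)
      (pair (pureStrategy a) (pureStrategy b))) :
    2 ≤ ∑ i, ((coordinationGame lo).expUtility i (pair (pureStrategy a) (pureStrategy b))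
      + 2 * p i (pair (pureStrategy a) (pureStrategy b))) := by
  -- The decisive deviation is to copy the other player's action.
  have h0 := hx 0 (pureStrategy b)
  have h1 := hx 1 (pureStrategy a)
  have n0 := hnn 0 (pair (pureStrategy a) (pureStrategy b))
  have n1 := hnn 1 (pair (pureStrategy a) (pureStrategy b))
  have n2 := hnn 0 (pair (pureStrategy b) (pureStrategy b))
  have n3 := hnn 1 (pair (pureStrategy a) (pureStrategy a))
  simp only [update_pair_zero, update_pair_one, NormalFormGame.augUtility, expUtility_eq,
    pair_zero, pair_one, pureStrategy_apply, Fin.sum_univ_two] at *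
  fin_cases a <;> fin_cases b <;> simp at * <;> linarith

/-- Player `0` strictly prefers to mismatch either pure action of the other player. -/
def FirstMismatches (v : Fin 2 → MixedProfile (Fin 2) (fun _ => Fin 2) → ℝ) : Prop :=
  ∀ a b, a ≠ b → v 0 (pair (pureStrategy b) (pureStrategy b)) <
    v 0 (pair (pureStrategy a) (pureStrategy b))

/-- Player `1` strictly prefers to mismatch either pure action of the other player. -/
def SecondMismatches (v : Fin 2 → MixedProfile (Fin 2) (fun _ => Fin 2) → ℝ) : Prop :=
  ∀ a b, a ≠ b → v 1 (pair (pureStrategy a) (pureStrategy a)) <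
    v 1 (pair (pureStrategy a) (pureStrategy b))

theorem OwnLinear.isNash_pair_iff {v : Fin 2 → MixedProfile (Fin 2) (fun _ => Fin 2) → ℝ}
    (hv : OwnLinear v) (a b : stdSimplex ℝ (Fin 2)) :
    IsNash v (pair a b) ↔ (∀ c, v 0 (pair (pureStrategy c) b) ≤ v 0 (pair a b)) ∧
      ∀ c, v 1 (pair a (pureStrategy c)) ≤ v 1 (pair a b) := by
  simp [hv.isNash_iff, Fin.forall_fin_two]

/-- If neither player always mismatches, player 0 is content at some (b, b) and player 1 at some (a,
a). Without a pure equilibrium, player 1 wants to leave (b, b), so a ≠ b, and player 0 wants to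
leave (a, a). Both moves lead to (b, a), where neither player gains by moving back: a pure
equilibrium after all. -/
theorem exists_pure_isNash_or_mismatches
    {v : Fin 2 → MixedProfile (Fin 2) (fun _ => Fin 2) → ℝ} (hv : OwnLinear v) :
    (∃ a b, IsNash v (pair (pureStrategy a) (pureStrategy b))) ∨
      FirstMismatches v ∨ SecondMismatches v := by
  by_contra! h
  obtain ⟨h, h0, h1⟩ := h
  simp only [hv.isNash_pair_iff, FirstMismatches, SecondMismatches, Fin.forall_fin_two] at h h0 h1
  simp at h h0 h1
  grind

theorem OwnLinear.pair_left {v : Fin 2 → MixedProfile (Fin 2) (fun _ => Fin 2) → ℝ}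
    (hv : OwnLinear v) (a b : stdSimplex ℝ (Fin 2)) :
    v 0 (pair a b) = a 0 * v 0 (pair (pureStrategy 0) b) + a 1 * v 0 (pair (pureStrategy 1) b) := by
  simpa [Fin.sum_univ_two] using hv.apply 0 (pair a b)

theorem OwnLinear.pair_right {v : Fin 2 → MixedProfile (Fin 2) (fun _ => Fin 2) → ℝ}
    (hv : OwnLinear v) (a b : stdSimplex ℝ (Fin 2)) :
    v 1 (pair a b) = b 0 * v 1 (pair a (pureStrategy 0)) + b 1 * v 1 (pair a (pureStrategy 1)) := by
  simpa [Fin.sum_univ_two] using hv.apply 1 (pair a b)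

theorem FirstMismatches.payment_lower_bound {lo : ℝ} {p : Payment (Fin 2) fun _ => Fin 2}
    (hnn : ∀ i x, 0 ≤ p i x) (h : FirstMismatches ((coordinationGame lo).augUtility p))
    {a b : Fin 2} (hab : a ≠ b) :
    1 - lo ≤ p 0 (pair (pureStrategy a) (pureStrategy b)) := by
  have h1 := h a b hab
  have n := hnn 0 (pair (pureStrategy b) (pureStrategy b))
  simp only [NormalFormGame.augUtility, expUtility_eq, pair_zero, pair_one,
    pureStrategy_apply] at h1
  fin_cases a <;> fin_cases b <;> simp at * <;> linarith

theorem SecondMismatches.payment_lower_bound {lo : ℝ} {p : Payment (Fin 2) fun _ => Fin 2}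
    (hnn : ∀ i x, 0 ≤ p i x) (h : SecondMismatches ((coordinationGame lo).augUtility p))
    {a b : Fin 2} (hab : a ≠ b) :
    1 - lo ≤ p 1 (pair (pureStrategy a) (pureStrategy b)) := by
  have h1 := h a b hab
  have n := hnn 1 (pair (pureStrategy a) (pureStrategy a))
  simp only [NormalFormGame.augUtility, expUtility_eq, pair_zero, pair_one,
    pureStrategy_apply] at h1
  fin_cases a <;> fin_cases b <;> simp at * <;> linarith

/-- Disagreement costs the two players 2 (1 - ℓ) in total, and player 0 alone is paid at least 1 - ℓ
there, counted twice. Own-linearity of player 0's payment averages this over the strategy `a`; the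
opponent has to be pure, since nothing is known about how that payment depends on a mixed opponent.
-/
theorem FirstMismatches.welfare_bound {lo : ℝ} {p : Payment (Fin 2) fun _ => Fin 2}
    (hp : OwnLinear p) (hnn : ∀ i x, 0 ≤ p i x)
    (h : FirstMismatches ((coordinationGame lo).augUtility p)) (a : stdSimplex ℝ (Fin 2))
    (b : Fin 2) :
    2 ≤ ∑ i, ((coordinationGame lo).expUtility i (pair a (pureStrategy b))
      + 2 * p i (pair a (pureStrategy b))) := by
  have hs := strategy_sum a
  have a0 := strategy_nonneg a 0
  have a1 := strategy_nonneg a 1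
  have n1 := hnn 1 (pair a (pureStrategy b))
  simp only [Fin.sum_univ_two, expUtility_eq, pair_zero, pair_one, pureStrategy_apply,
    hp.pair_left a]
  fin_cases b
  · have n0 := mul_le_mul_of_nonneg_left
      (h.payment_lower_bound hnn (show (1 : Fin 2) ≠ 0 by decide)) a1
    have n2 := mul_nonneg a0 (hnn 0 (pair (pureStrategy 0) (pureStrategy 0)))
    simp at *
    linear_combination 2 * n0 + 2 * n1 + 2 * n2 - 2 * (1 - lo) * hs
  · have n0 := mul_le_mul_of_nonneg_left
      (h.payment_lower_bound hnn (show (0 : Fin 2) ≠ 1 by decide)) a0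
    have n2 := mul_nonneg a1 (hnn 0 (pair (pureStrategy 1) (pureStrategy 1)))
    simp at *
    linear_combination 2 * n0 + 2 * n1 + 2 * n2 - 2 * (1 - lo) * hs

theorem SecondMismatches.welfare_bound {lo : ℝ} {p : Payment (Fin 2) fun _ => Fin 2}
    (hp : OwnLinear p) (hnn : ∀ i x, 0 ≤ p i x)
    (h : SecondMismatches ((coordinationGame lo).augUtility p)) (a : Fin 2)
    (b : stdSimplex ℝ (Fin 2)) :
    2 ≤ ∑ i, ((coordinationGame lo).expUtility i (pair (pureStrategy a) b)
      + 2 * p i (pair (pureStrategy a) b)) := by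
  have hs := strategy_sum b
  have b0 := strategy_nonneg b 0
  have b1 := strategy_nonneg b 1
  have n1 := hnn 0 (pair (pureStrategy a) b)
  simp only [Fin.sum_univ_two, expUtility_eq, pair_zero, pair_one, pureStrategy_apply,
    hp.pair_right _ b]
  fin_cases a
  · have n0 := mul_le_mul_of_nonneg_left
      (h.payment_lower_bound hnn (show (0 : Fin 2) ≠ 1 by decide)) b1
    have n2 := mul_nonneg b0 (hnn 1 (pair (pureStrategy 0) (pureStrategy 0)))
    simp at *
    linear_combination 2 * n0 + 2 * n1 + 2 * n2 - 2 * (1 - lo) * hs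
  · have n0 := mul_le_mul_of_nonneg_left
      (h.payment_lower_bound hnn (show (1 : Fin 2) ≠ 0 by decide)) b0
    have n2 := mul_nonneg b1 (hnn 1 (pair (pureStrategy 1) (pureStrategy 1)))
    simp at *
    linear_combination 2 * n0 + 2 * n1 + 2 * n2 - 2 * (1 - lo) * hs

/-- For every reference profile, the players can do at least as well as their reference strategies
while the payments make up for the welfare lost to disagreement. -/
theorem exists_response {lo : ℝ} (hlo : lo < 1) {p : Payment (Fin 2) fun _ => Fin 2}
    (hp : OwnLinear p) (hnn : ∀ i x, 0 ≤ p i x) (r : MixedProfile (Fin 2) fun _ => Fin 2) :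
    ∃ x, (∀ i, (coordinationGame lo).augUtility p i (Function.update x i (r i)) ≤
        (coordinationGame lo).augUtility p i x) ∧
      2 ≤ ∑ i, ((coordinationGame lo).expUtility i x + 2 * p i x) := by
  have hv := ownLinear_augUtility lo hp
  rcases exists_pure_isNash_or_mismatches hv with ⟨a, b, h⟩ | h | h
  · exact ⟨_, fun i => h i (r i), welfare_bound_of_isNash_pure hlo hnn a b h⟩
  -- The mismatching player keeps the reference strategy, so its comparison is trivial. The other
  -- player takes a best pure reply, which beats its reference strategy and keeps the opponent of
  -- the mismatcher pure.
  · obtain ⟨b, hb⟩ := Finite.exists_max fun b =>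
      (coordinationGame lo).augUtility p 1 (pair (r 0) (pureStrategy b))
    refine ⟨pair (r 0) (pureStrategy b), ?_, h.welfare_bound hp hnn _ _⟩
    rw [Fin.forall_fin_two]
    exact ⟨by simp, hv.le_of_forall_vertex (by simpa using hb) _⟩
  · obtain ⟨a, ha⟩ := Finite.exists_max fun a =>
      (coordinationGame lo).augUtility p 0 (pair (pureStrategy a) (r 1))
    refine ⟨pair (pureStrategy a) (r 1), ?_, h.welfare_bound hp hnn _ _⟩
    rw [Fin.forall_fin_two]
    exact ⟨hv.le_of_forall_vertex (by simpa using ha) _, by simp⟩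

/-! ### Payments at outcomes: equilibria that are pure if possible -/

theorem expect_nonneg {q : (Fin 2 → Fin 2) → ℝ} (hq : ∀ z, 0 ≤ q z)
    (x : MixedProfile (Fin 2) fun _ => Fin 2) : 0 ≤ expect q x :=
  Finset.sum_nonneg fun z _ =>
    mul_nonneg (Finset.prod_nonneg fun i _ => strategy_nonneg (x i) (z i)) (hq z)

/-- A strategy that makes an affine function with opposite strict signs at the two actions
vanish. -/
theorem exists_strategy_eq_zero {c d : ℝ} (h : c < 0 ∧ 0 < d ∨ 0 < c ∧ d < 0) :
    ∃ a : stdSimplex ℝ (Fin 2), a 0 * c + a 1 * d = 0 := by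
  have hcd : d - c ≠ 0 := by rcases h with h | h <;> intro h' <;> linarith
  refine ⟨strategyOf (d / (d - c)) ?_ ?_, ?_⟩
  · rcases h with h | h
    · exact div_nonneg (by linarith) (by linarith)
    · exact div_nonneg_of_nonpos (by linarith) (by linarith)
  · rcases h with h | h
    · exact (div_le_one (by linarith)).2 (by linarith)
    · exact (div_le_one_of_neg (by linarith)).2 (by linarith)
  · simp only [strategyOf_zero, strategyOf_one]
    field_simp
    ring

theorem expect_pair_left (q : (Fin 2 → Fin 2) → ℝ) (a b : stdSimplex ℝ (Fin 2)) :
    expect q (pair a b) =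
      a 0 * expect q (pair (pureStrategy 0) b) + a 1 * expect q (pair (pureStrategy 1) b) :=
  (ownLinear_expect fun _ => q).pair_left a b

theorem expect_pair_right (q : (Fin 2 → Fin 2) → ℝ) (a b : stdSimplex ℝ (Fin 2)) :
    expect q (pair a b) =
      b 0 * expect q (pair a (pureStrategy 0)) + b 1 * expect q (pair a (pureStrategy 1)) :=
  (ownLinear_expect fun _ => q).pair_right a b

/-- Every two-player game with two actions each has a Nash equilibrium. -/
theorem exists_isNash_expect (w : Fin 2 → (Fin 2 → Fin 2) → ℝ) :
    ∃ x : MixedProfile (Fin 2) fun _ => Fin 2, IsNash (fun i => expect (w i)) x := by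
  have hv := ownLinear_expect w
  by_cases hpure : ∃ a b, IsNash (fun i => expect (w i)) (pair (pureStrategy a) (pureStrategy b))
  · obtain ⟨a, b, h⟩ := hpure
    exact ⟨_, h⟩
  have hm := (exists_pure_isNash_or_mismatches hv).resolve_left hpure
  push Not at hpure
  simp only [hv.isNash_pair_iff, FirstMismatches, SecondMismatches, Fin.forall_fin_two]
    at hpure hm
  simp at hpure hm
  -- Without a pure equilibrium, best replies cycle, so each player's preference between its actions
  -- reverses with the opponent's action. Each strategy is chosen to make the other player
  -- indifferent.
  obtain ⟨b, hb⟩ := exists_strategy_eq_zero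
    (c := expect (w 0) (pair (pureStrategy 0) (pureStrategy 0))
      - expect (w 0) (pair (pureStrategy 1) (pureStrategy 0)))
    (d := expect (w 0) (pair (pureStrategy 0) (pureStrategy 1))
      - expect (w 0) (pair (pureStrategy 1) (pureStrategy 1))) (by grind)
  obtain ⟨a, ha⟩ := exists_strategy_eq_zero
    (c := expect (w 1) (pair (pureStrategy 0) (pureStrategy 0))
      - expect (w 1) (pair (pureStrategy 0) (pureStrategy 1)))
    (d := expect (w 1) (pair (pureStrategy 1) (pureStrategy 0))
      - expect (w 1) (pair (pureStrategy 1) (pureStrategy 1))) (by grind)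
  have sa := strategy_sum a
  have sb := strategy_sum b
  have eb : expect (w 0) (pair (pureStrategy 0) b) = expect (w 0) (pair (pureStrategy 1) b) := by
    rw [expect_pair_right _ _ b, expect_pair_right _ _ b]
    linarith
  have ea : expect (w 1) (pair a (pureStrategy 0)) = expect (w 1) (pair a (pureStrategy 1)) := by
    rw [expect_pair_left _ a, expect_pair_left _ a]
    linarith
  refine ⟨pair a b, (hv.isNash_pair_iff a b).2 ⟨fun c => ?_, fun c => ?_⟩⟩
  · rw [expect_pair_left _ a b, eb, ← add_mul, sa, one_mul]
    fin_cases c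
    exacts [eb.le, le_rfl]
  · rw [expect_pair_right _ a b, ea, ← add_mul, sb, one_mul]
    fin_cases c
    exacts [ea.le, le_rfl]

theorem ownLinear_outcomePayment (q : Fin 2 → (Fin 2 → Fin 2) → ℝ) :
    OwnLinear (outcomePayment q) :=
  ownLinear_expect q

theorem augUtility_outcomePayment (lo : ℝ) (q : Fin 2 → (Fin 2 → Fin 2) → ℝ) :
    (coordinationGame lo).augUtility (outcomePayment q) =
      fun i => expect fun z => (coordinationGame lo).utility i z + q i z := by
  ext i x
  simp [NormalFormGame.augUtility, NormalFormGame.expUtility, outcomePayment, expect, mul_add,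
    Finset.sum_add_distrib]

/-- Equilibria of the augmented game that are pure whenever there is a pure one. -/
def IsPureIfPossibleNash (v : Fin 2 → MixedProfile (Fin 2) (fun _ => Fin 2) → ℝ)
    (x : MixedProfile (Fin 2) fun _ => Fin 2) : Prop :=
  IsNash v x ∧ (IsPure x ∨ ∀ y, IsPure y → ¬ IsNash v y)

theorem exists_isPureIfPossibleNash (lo : ℝ) (q : Fin 2 → (Fin 2 → Fin 2) → ℝ) :
    ∃ x, IsPureIfPossibleNash ((coordinationGame lo).augUtility (outcomePayment q)) x := by
  by_cases h : ∃ y, IsPure y ∧ IsNash ((coordinationGame lo).augUtility (outcomePayment q)) y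
  · obtain ⟨y, hy, hn⟩ := h
    exact ⟨y, hn, .inl hy⟩
  · rw [augUtility_outcomePayment] at h ⊢
    obtain ⟨x, hx⟩ := exists_isNash_expect
      fun i z => (coordinationGame lo).utility i z + q i z
    exact ⟨x, hx, .inr fun y hy hn => h ⟨y, hy, hn⟩⟩

/-- When no pure equilibrium exists, one player mismatches and the bound holds against each pure
opponent. Outcome payments are also linear in the opponent's strategy, so averaging gives it at
every mixed profile. -/
theorem IsPureIfPossibleNash.welfare_bound {lo : ℝ} (hlo : lo < 1)
    {q : Fin 2 → (Fin 2 → Fin 2) → ℝ} (hq : ∀ i z, 0 ≤ q i z)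
    {x : MixedProfile (Fin 2) fun _ => Fin 2}
    (hx : IsPureIfPossibleNash ((coordinationGame lo).augUtility (outcomePayment q)) x) :
    2 ≤ ∑ i, ((coordinationGame lo).expUtility i x + 2 * outcomePayment q i x) := by
  have hnn i x : 0 ≤ outcomePayment q i x := expect_nonneg (hq i) x
  have hp := ownLinear_outcomePayment q
  obtain ⟨hx, ⟨z, rfl⟩ | hx'⟩ := hx
  · rw [pureProfile_eq_pair] at hx ⊢
    exact welfare_bound_of_isNash_pure hlo hnn _ _ hx
  · rw [eq_pair x]
    rcases exists_pure_isNash_or_mismatches (ownLinear_augUtility lo hp) with ⟨a, b, h⟩ | h | h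
    · exact absurd h (hx' _ (isPure_pair a b))
    · have h0 := mul_le_mul_of_nonneg_left (h.welfare_bound hp hnn (x 0) 0) (strategy_nonneg (x 1) 0)
      have h1 := mul_le_mul_of_nonneg_left (h.welfare_bound hp hnn (x 0) 1) (strategy_nonneg (x 1) 1)
      have s := strategy_sum (x 1)
      simp only [Fin.sum_univ_two, NormalFormGame.expUtility, outcomePayment] at h0 h1 ⊢
      simp only [expect_pair_right _ (x 0) (x 1)]
      linarith
    · have h0 := mul_le_mul_of_nonneg_left (h.welfare_bound hp hnn 0 (x 1)) (strategy_nonneg (x 0) 0)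
      have h1 := mul_le_mul_of_nonneg_left (h.welfare_bound hp hnn 1 (x 1)) (strategy_nonneg (x 0) 1)
      have s := strategy_sum (x 0)
      simp only [Fin.sum_univ_two, NormalFormGame.expUtility, outcomePayment] at h0 h1 ⊢
      simp only [expect_pair_left _ (x 0) (x 1)]
      linarith

/-! ### Regret matching with responses -/

/-- The regret-matching strategy: proportional to the positive parts of the regrets `r`. -/
def regretMatching (r : Fin 2 → ℝ) : stdSimplex ℝ (Fin 2) :=
  if h : 0 < ∑ a, max (r a) 0 then
    ⟨fun a => max (r a) 0 / ∑ b, max (r b) 0, fun _ => div_nonneg (le_max_right _ _) h.le, by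
      rw [← Finset.sum_div, div_self h.ne']⟩
  else pureStrategy 0

/-- Blackwell's condition as an inequality: the realized payoff `c` need not come from the
regret-matching strategy, only be at least as good. -/
theorem sum_mul_sub_nonpos_of_regretMatching (r w : Fin 2 → ℝ) {c : ℝ}
    (h : ∑ a, regretMatching r a * w a ≤ c) : ∑ a, max (r a) 0 * (w a - c) ≤ 0 := by
  by_cases hr : 0 < ∑ a, max (r a) 0
  · have h' : (∑ a, max (r a) 0 * w a) / ∑ a, max (r a) 0 ≤ c := by
      rw [Finset.sum_div]
      refine le_trans (le_of_eq (Finset.sum_congr rfl fun a _ => ?_)) h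
      rw [regretMatching, dif_pos hr]
      exact mul_div_right_comm _ _ _
    rw [div_le_iff₀ hr] at h'
    simp only [mul_sub, Finset.sum_sub_distrib, ← Finset.sum_mul]
    linarith
  · have h0 : ∀ a ∈ Finset.univ, 0 ≤ max (r a) 0 := fun a _ => le_max_right _ _
    have hz := (Finset.sum_eq_zero_iff_of_nonneg h0).1
      (le_antisymm (not_lt.1 hr) (Finset.sum_nonneg h0))
    exact (Finset.sum_eq_zero fun a ha => by rw [hz a ha, zero_mul]).le

/-- One step of the quadratic potential; truncation at zero can only decrease the square. -/
theorem max_add_zero_sq_le (r d : ℝ) :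
    max (r + d) 0 ^ 2 ≤ max r 0 ^ 2 + 2 * (max r 0 * d) + d ^ 2 := by
  have h : max r 0 ^ 2 + 2 * (max r 0 * d) + d ^ 2 = (max r 0 + d) ^ 2 := by ring
  rw [h]
  rcases le_total (r + d) 0 with h' | h'
  · rw [max_eq_right h', zero_pow two_ne_zero]
    positivity
  · rw [max_eq_left h']
    exact pow_le_pow_left₀ h' (by linarith [le_max_left r 0]) 2

/-- A profile as provided by `exists_response`. -/
def response (lo : ℝ) (p : Payment (Fin 2) fun _ => Fin 2)
    (r : MixedProfile (Fin 2) fun _ => Fin 2) : MixedProfile (Fin 2) fun _ => Fin 2 :=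
  haveI : Nonempty (MixedProfile (Fin 2) fun _ => Fin 2) := ⟨r⟩
  Classical.epsilon fun x =>
    (∀ i, (coordinationGame lo).augUtility p i (Function.update x i (r i)) ≤
      (coordinationGame lo).augUtility p i x) ∧
    2 ≤ ∑ i, ((coordinationGame lo).expUtility i x + 2 * p i x)

theorem IsPayment.response_spec {lo : ℝ} (hlo : lo < 1) {P : ℝ}
    {p : Payment (Fin 2) fun _ => Fin 2} (hp : IsPayment P p)
    (r : MixedProfile (Fin 2) fun _ => Fin 2) :
    (∀ i, (coordinationGame lo).augUtility p i (Function.update (response lo p r) i (r i)) ≤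
      (coordinationGame lo).augUtility p i (response lo p r)) ∧
    2 ≤ ∑ i, ((coordinationGame lo).expUtility i (response lo p r)
      + 2 * p i (response lo p r)) :=
  Classical.epsilon_spec (exists_response hlo hp.ownLinear (fun i x => (hp.mem_Icc i x).1) r)

/-- The gain of player `i` from playing the pure action `a` instead of `x i`. -/
def instantRegret (lo : ℝ) (p : Payment (Fin 2) fun _ => Fin 2)
    (x : MixedProfile (Fin 2) fun _ => Fin 2) (i a : Fin 2) : ℝ :=
  (coordinationGame lo).augUtility p i (Function.update x i (pureStrategy a))
    - (coordinationGame lo).augUtility p i x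

/-- The cumulative regrets of players who respond to their regret-matching strategies. -/
def cumulativeRegret (lo : ℝ) (p : ℕ → Payment (Fin 2) fun _ => Fin 2) :
    ℕ → Fin 2 → Fin 2 → ℝ
  | 0 => 0
  | t + 1 => cumulativeRegret lo p t +
      instantRegret lo (p t)
        (response lo (p t) fun i => regretMatching (cumulativeRegret lo p t i))

theorem cumulativeRegret_congr (lo : ℝ) {p p' : ℕ → Payment (Fin 2) fun _ => Fin 2} {t : ℕ}
    (h : ∀ s < t, p s = p' s) : cumulativeRegret lo p t = cumulativeRegret lo p' t := by
  induction t with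
  | zero => rfl
  | succ t ih =>
    simp only [cumulativeRegret, h t t.lt_succ_self, ih fun s hs => h s (hs.trans t.lt_succ_self)]

/-- Both players respond to their regret-matching strategies. -/
def matchingAlgorithm (lo : ℝ) : PlayerAlgorithm (Fin 2) fun _ => Fin 2 := fun t h =>
  response lo (h (Fin.last t)) fun i =>
    -- `Fin.ofNat` wraps around for `s > t`, but only rounds before `t` are read here; the payment
    -- of round `t` enters only through the response.
    regretMatching (cumulativeRegret lo (fun s => h (Fin.ofNat (t + 1) s)) t i)

theorem play_matchingAlgorithm (lo : ℝ) (p : ℕ → Payment (Fin 2) fun _ => Fin 2) (t : ℕ) :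
    (matchingAlgorithm lo).play p t =
      response lo (p t) fun i => regretMatching (cumulativeRegret lo p t i) := by
  have h : cumulativeRegret lo (fun s => p (Fin.ofNat (t + 1) s : Fin (t + 1))) t =
      cumulativeRegret lo p t :=
    cumulativeRegret_congr lo fun s hs => by
      simp [Fin.ofNat, Nat.mod_eq_of_lt (hs.trans t.lt_succ_self)]
  simp only [PlayerAlgorithm.play, matchingAlgorithm, h, Fin.val_last]

theorem cumulativeRegret_eq_sum (lo : ℝ) (p : ℕ → Payment (Fin 2) fun _ => Fin 2) (t : ℕ)
    (i a : Fin 2) : cumulativeRegret lo p t i a =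
      ∑ s ∈ Finset.range t, instantRegret lo (p s) ((matchingAlgorithm lo).play p s) i a := by
  induction t with
  | zero => rfl
  | succ t ih => rw [Finset.sum_range_succ, ← ih, play_matchingAlgorithm]; rfl

theorem IsPayment.abs_instantRegret_le {lo : ℝ} (hlo : lo < 1) {P : ℝ}
    {p : Payment (Fin 2) fun _ => Fin 2} (hp : IsPayment P p)
    (x : MixedProfile (Fin 2) fun _ => Fin 2) (i a : Fin 2) :
    |instantRegret lo p x i a| ≤ P + (1 - lo) := by
  have h1 := expUtility_mem_Icc hlo i x
  have h2 := expUtility_mem_Icc hlo i (Function.update x i (pureStrategy a))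
  have h3 := hp.mem_Icc i x
  have h4 := hp.mem_Icc i (Function.update x i (pureStrategy a))
  simp only [instantRegret, NormalFormGame.augUtility, Set.mem_Icc] at *
  rw [abs_le]
  constructor <;> linarith

theorem sum_sq_max_cumulativeRegret_le {lo : ℝ} (hlo : lo < 1) {P : ℝ}
    {p : ℕ → Payment (Fin 2) fun _ => Fin 2} (hp : ∀ t, IsPayment P (p t)) (t : ℕ) (i : Fin 2) :
    ∑ a, max (cumulativeRegret lo p t i a) 0 ^ 2 ≤ t * (2 * (P + (1 - lo)) ^ 2) := by
  induction t with
  | zero => simp [cumulativeRegret]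
  | succ t ih =>
    set x := response lo (p t) fun i => regretMatching (cumulativeRegret lo p t i) with hx
    -- The first-order term of the potential is nonpositive because each player does at least as
    -- well as its regret-matching strategy; only the squared increments remain.
    have hd : ∑ a, max (cumulativeRegret lo p t i a) 0 * instantRegret lo (p t) x i a ≤ 0 := by
      refine sum_mul_sub_nonpos_of_regretMatching _ _ ?_
      rw [← ownLinear_augUtility lo (hp t).ownLinear i x]
      exact ((hp t).response_spec hlo _).1 i
    have hs : ∑ a, instantRegret lo (p t) x i a ^ 2 ≤ 2 * (P + (1 - lo)) ^ 2 := by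
      refine (Finset.sum_le_card_nsmul Finset.univ _ ((P + (1 - lo)) ^ 2) fun a _ => ?_).trans
        (by simp)
      exact sq_le_sq' (neg_le_of_abs_le ((hp t).abs_instantRegret_le hlo x i a))
        (le_of_abs_le ((hp t).abs_instantRegret_le hlo x i a))
    calc ∑ a, max (cumulativeRegret lo p (t + 1) i a) 0 ^ 2
        ≤ ∑ a, (max (cumulativeRegret lo p t i a) 0 ^ 2
          + 2 * (max (cumulativeRegret lo p t i a) 0 * instantRegret lo (p t) x i a)
          + instantRegret lo (p t) x i a ^ 2) := Finset.sum_le_sum fun a _ => max_add_zero_sq_le _ _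
      _ ≤ (t + 1 : ℕ) * (2 * (P + (1 - lo)) ^ 2) := by
        rw [Finset.sum_add_distrib, Finset.sum_add_distrib, ← Finset.mul_sum]
        push_cast
        linarith

theorem regret_le {Γ : NormalFormGame (Fin 2) fun _ => Fin 2} {P B : ℝ} (hP : 0 ≤ P)
    {p : ℕ → Payment (Fin 2) fun _ => Fin 2} {x : ℕ → MixedProfile (Fin 2) fun _ => Fin 2}
    {i : Fin 2} {T : ℕ}
    (h : ∀ y : stdSimplex ℝ (Fin 2), ∑ t ∈ Finset.range T,
      (Γ.augUtility (p t) i (Function.update (x t) i y) - Γ.augUtility (p t) i (x t))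
        ≤ (P + 1) * B) :
    Γ.regret P p x i T ≤ B := by
  have hP' : 0 < P + 1 := by linarith
  rw [NormalFormGame.regret, one_div, inv_mul_le_iff₀ hP', sub_le_iff_le_add]
  refine ciSup_le fun y => ?_
  have := h y
  rw [Finset.sum_sub_distrib] at this
  linarith

theorem regret_matchingAlgorithm_le {lo : ℝ} (hlo : lo < 1) {P : ℝ}
    {p : ℕ → Payment (Fin 2) fun _ => Fin 2} (hp : ∀ t, IsPayment P (p t)) (i : Fin 2) (T : ℕ) :
    (coordinationGame lo).regret P p ((matchingAlgorithm lo).play p) i T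
      ≤ 2 * (2 - lo) * Real.sqrt T := by
  have hP : 0 ≤ P :=
    haveI : Nonempty (MixedProfile (Fin 2) fun _ => Fin 2) := ⟨uniformProfile⟩
    (hp 0).bound_nonneg
  refine regret_le hP fun y => ?_
  have hB : 0 ≤ (P + 1) * (2 * (2 - lo) * Real.sqrt T) := by
    have : 0 < 2 - lo := by linarith
    positivity
  have hr (a : Fin 2) : cumulativeRegret lo p T i a ≤ (P + 1) * (2 * (2 - lo) * Real.sqrt T) := by
    refine (le_max_left _ 0).trans (abs_le_of_sq_le_sq' ?_ hB).2
    calc max (cumulativeRegret lo p T i a) 0 ^ 2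
        ≤ ∑ a, max (cumulativeRegret lo p T i a) 0 ^ 2 :=
          Finset.single_le_sum (f := fun a => max (cumulativeRegret lo p T i a) 0 ^ 2)
            (fun _ _ => sq_nonneg _) (Finset.mem_univ a)
      _ ≤ T * (2 * (P + (1 - lo)) ^ 2) := sum_sq_max_cumulativeRegret_le hlo hp T i
      -- Since P + (1 - ℓ) ≤ (P + 1)(2 - ℓ), the normalization by P + 1 removes the dependence on P;
      -- the factor √2 is rounded up to 2.
      _ ≤ T * (2 * ((P + 1) * (2 - lo))) ^ 2 := by
        refine mul_le_mul_of_nonneg_left ?_ T.cast_nonneg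
        have : (P + (1 - lo)) ^ 2 ≤ ((P + 1) * (2 - lo)) ^ 2 :=
          pow_le_pow_left₀ (by linarith) (by nlinarith) 2
        rw [mul_pow]
        nlinarith [sq_nonneg ((P + 1) * (2 - lo))]
      _ = ((P + 1) * (2 * (2 - lo) * Real.sqrt T)) ^ 2 := by
        rw [mul_pow (P + 1), mul_pow (2 * (2 - lo)), Real.sq_sqrt T.cast_nonneg]
        ring
  calc _ = ∑ a, y a * cumulativeRegret lo p T i a := by
        simp only [cumulativeRegret_eq_sum, Finset.mul_sum]
        rw [Finset.sum_comm]
        refine Finset.sum_congr rfl fun t _ => ?_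
        rw [ownLinear_augUtility lo (hp t).ownLinear i _ y]
        simp only [instantRegret, mul_sub, Finset.sum_sub_distrib, ← Finset.sum_mul]
        rw [show ∑ a, y a = 1 from y.2.2, one_mul]
    _ ≤ ∑ a, y a * ((P + 1) * (2 * (2 - lo) * Real.sqrt T)) :=
        Finset.sum_le_sum fun a _ => mul_le_mul_of_nonneg_left (hr a) (strategy_nonneg y a)
    _ = _ := by rw [← Finset.sum_mul, show ∑ a, y a = 1 from y.2.2, one_mul]

/-! ### Play against adaptive mediators and failure of steering -/

theorem exists_seq_of_history {X : Type*} (F : (t : ℕ) → (Fin t → X) → X) :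
    ∃ x : ℕ → X, ∀ t, x t = F t fun s => x s := by
  let G : (t : ℕ) → X := fun t => Nat.strongRec (motive := fun _ => X)
    (fun t ih => F t fun s => ih s s.2) t
  refine ⟨G, fun t => ?_⟩
  simp only [G]
  rw [Nat.strongRec_eq]

theorem abs_average_expect_sub_le (f : (Fin 2 → Fin 2) → ℝ) {K : ℝ} (hf : ∀ z, |f z| ≤ K)
    (d : MixedProfile (Fin 2) fun _ => Fin 2) (x : ℕ → MixedProfile (Fin 2) fun _ => Fin 2)
    (T : ℕ) :
    |1 / (T : ℝ) * ∑ t ∈ Finset.range T, expect f (x t) - expect f d| ≤ K * directnessGap d x T := by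
  have h : 1 / (T : ℝ) * ∑ t ∈ Finset.range T, expect f (x t) - expect f d =
      ∑ z, ((1 / (T : ℝ) * ∑ t ∈ Finset.range T, outcomeProb (x t) z) - outcomeProb d z) * f z := by
    simp only [expect, sub_mul, Finset.sum_sub_distrib, mul_assoc, Finset.sum_mul]
    rw [Finset.sum_comm, Finset.mul_sum]
  rw [h, directnessGap, Finset.mul_sum]
  refine (Finset.abs_sum_le_sum_abs _ _).trans (Finset.sum_le_sum fun z _ => ?_)
  rw [abs_mul, mul_comm]
  exact mul_le_mul_of_nonneg_right (hf z) (abs_nonneg _)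

/-- Plays in which the payments always make up for the welfare lost to disagreement are not
steered to the uniform profile. -/
theorem not_tendsto_of_welfare_bound {lo : ℝ} (hlo : lo < 1)
    {p : ℕ → ℕ → Payment (Fin 2) fun _ => Fin 2}
    {x : ℕ → ℕ → MixedProfile (Fin 2) fun _ => Fin 2}
    (h : ∀ T t, 2 ≤ ∑ i, ((coordinationGame lo).expUtility i (x T t) + 2 * p T t i (x T t)))
    (hpay : Tendsto (fun T => averagePayment (p T) (x T) T) atTop (𝓝 0))
    (hgap : Tendsto (fun T => directnessGap uniformProfile (x T) T) atTop (𝓝 0)) : False := by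
  set u := (coordinationGame lo).utility 0 with hu
  have hud : expect u uniformProfile = (1 + lo) / 2 := by
    change (coordinationGame lo).expUtility 0 uniformProfile = _
    simp only [expUtility_eq, uniformProfile_apply]
    ring
  have hK (z : Fin 2 → Fin 2) : |u z| ≤ 1 + |lo| := by
    simp only [hu, coordinationGame]
    split_ifs
    · simp
    · linarith
  -- The factor 2 on the gap reflects two equal utilities; 4 bounds two players' payments, each
  -- counted twice, by their maximum.
  have key : ∀ᶠ T in atTop, 2 ≤ (1 + lo)
      + 2 * ((1 + |lo|) * directnessGap uniformProfile (x T) T)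
      + 4 * averagePayment (p T) (x T) T := by
    filter_upwards [eventually_gt_atTop 0] with T hT
    have hT' : (0 : ℝ) < T := Nat.cast_pos.2 hT
    have h1 := le_of_abs_le (abs_average_expect_sub_le u hK uniformProfile (x T) T)
    have h2 (i : Fin 2) : 1 / (T : ℝ) * ∑ t ∈ Finset.range T, p T t i (x T t) ≤
        averagePayment (p T) (x T) T :=
      le_ciSup (f := fun i => 1 / (T : ℝ) * ∑ t ∈ Finset.range T, p T t i (x T t))
        (Set.finite_range _).bddAbove i
    have h3 : 2 ≤ 1 / (T : ℝ) * ∑ t ∈ Finset.range T,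
        (2 * expect u (x T t) + 2 * p T t 0 (x T t) + 2 * p T t 1 (x T t)) := by
      rw [one_div, le_inv_mul_iff₀ hT']
      calc (T : ℝ) * 2 = ∑ _t ∈ Finset.range T, (2 : ℝ) := by simp
        _ ≤ _ := Finset.sum_le_sum fun t _ => by
          have := h T t
          rw [Fin.sum_univ_two] at this
          change _ ≤ expect u (x T t) + _ + (expect u (x T t) + _) at this
          linarith
    simp only [Finset.sum_add_distrib, ← Finset.mul_sum, mul_add] at h3
    have h20 := h2 0
    have h21 := h2 1
    rw [hud] at h1
    linarith
  have hlim : Tendsto (fun T => (1 + lo)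
      + 2 * ((1 + |lo|) * directnessGap uniformProfile (x T) T)
      + 4 * averagePayment (p T) (x T) T) atTop (𝓝 ((1 + lo) + 2 * ((1 + |lo|) * 0) + 4 * 0)) :=
    ((((hgap.const_mul _).const_mul _).const_add _).add (hpay.const_mul _))
  have := ge_of_tendsto hlim key
  linarith

theorem Mediator.bound_nonneg (M : Mediator (Fin 2) fun _ => Fin 2) (T : ℕ) : 0 ≤ M.bound T :=
  haveI : Nonempty (MixedProfile (Fin 2) fun _ => Fin 2) := ⟨uniformProfile⟩
  (M.isPayment T 0 Fin.elim0).bound_nonneg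

theorem Mediator.not_steers_of_sqrt_le {lo : ℝ} (hlo : lo < 1) {R : ℕ → ℝ}
    (hR : ∀ T : ℕ, 2 * (2 - lo) * Real.sqrt T ≤ R T) (M : Mediator (Fin 2) fun _ => Fin 2) :
    ¬ M.Steers (coordinationGame lo) R uniformProfile := by
  intro hM
  have hx (T : ℕ) : ∃ x, ∀ t, x t = (matchingAlgorithm lo).play (M.offered T x) t :=
    -- The algorithm reads payments up to round t, but these depend only on profiles before round t,
    -- so the mutual recursion is well founded.
    exists_seq_of_history fun t h => matchingAlgorithm lo t
      fun s => M.pay T s fun r => h (r.castLE (Nat.lt_succ_iff.1 s.2))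
  choose x hx using hx
  have hx' (T : ℕ) : (matchingAlgorithm lo).play (M.offered T (x T)) = x T :=
    funext fun t => (hx T t).symm
  have hp (T t : ℕ) : IsPayment (M.bound T) (M.offered T (x T) t) := M.isPayment _ _ _
  obtain ⟨h1, h2⟩ := hM x fun T s _ i => by
    have := regret_matchingAlgorithm_le hlo (hp T) i s
    rw [hx'] at this
    exact this.trans (hR s)
  refine not_tendsto_of_welfare_bound hlo (fun T t => ?_) h1 h2
  rw [hx T t, play_matchingAlgorithm]
  have := ((hp T t).response_spec hlo fun i =>
    regretMatching (cumulativeRegret lo (M.offered T (x T)) t i)).2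
  exact this

theorem Mediator.not_steers_of_isOutcomeBased {lo : ℝ} (hlo : lo < 1) {R : ℕ → ℝ}
    (hR : ∀ T, 0 ≤ R T) {M : Mediator (Fin 2) fun _ => Fin 2} (hM : M.IsOutcomeBased) :
    ¬ M.Steers (coordinationGame lo) R uniformProfile := by
  intro hst
  have hnash (T t : ℕ) (h : Fin t → MixedProfile (Fin 2) fun _ => Fin 2) :
      ∃ x, IsNash ((coordinationGame lo).augUtility (M.pay T t h)) x ∧
        2 ≤ ∑ i, ((coordinationGame lo).expUtility i x + 2 * M.pay T t h i x) := by
    obtain ⟨q, hq⟩ := hM T t h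
    -- The payment at a pure profile is the outcome payment itself, so nonnegativity passes to `q`.
    have hnn (i : Fin 2) (z : Fin 2 → Fin 2) : 0 ≤ q i z := by
      have := ((M.isPayment T t h).mem_Icc i (pureProfile z)).1
      rw [hq, outcomePayment, expect_eq, pureProfile_eq_pair] at this
      obtain ⟨a, b, rfl⟩ : ∃ a b, z = ![a, b] := ⟨z 0, z 1, by ext i; fin_cases i <;> rfl⟩
      fin_cases a <;> fin_cases b <;> simpa [pureStrategy_apply] using this
    rw [hq]
    obtain ⟨x, hx⟩ := exists_isPureIfPossibleNash lo q
    exact ⟨x, hx.1, hx.welfare_bound hlo hnn⟩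
  choose F hF using hnash
  choose x hx using fun T => exists_seq_of_history (F T)
  have hF' (T t : ℕ) : IsNash ((coordinationGame lo).augUtility (M.offered T (x T) t)) (x T t) ∧
      2 ≤ ∑ i, ((coordinationGame lo).expUtility i (x T t)
        + 2 * M.offered T (x T) t i (x T t)) := by
    have := hF T t fun s => x T s
    rwa [← hx T t] at this
  obtain ⟨h1, h2⟩ := hst x fun T s _ i =>
    (regret_le (B := 0) (M.bound_nonneg T) fun y => by
      rw [mul_zero]
      exact Finset.sum_nonpos fun t _ => sub_nonpos.2 ((hF' T t).1 i y)).trans (hR s)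
  exact not_tendsto_of_welfare_bound hlo (fun T t => (hF' T t).2) h1 h2

end Steering

end

theorem mainTheorem8 (lo : ℝ) (hlo : lo < 1) :
    ∃ d : Steering.MixedProfile (Fin 2) (fun _ => Fin 2),
      -- the unique optimal equilibrium is the fully mixed one
      (∀ i a, d i a = 1 / 2) ∧ ¬ Steering.IsPure d ∧
      (∀ x, (Steering.coordinationGame lo).IsOptimalEquilibrium
        (Steering.welfareMinObjective lo) x ↔ x = d) ∧
      -- payments at outcomes: equilibrium play in every round, pure if possible
      (∀ q : Fin 2 → (Fin 2 → Fin 2) → ℝ, (∀ i z, 0 ≤ q i z) →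
        (∃ x, Steering.IsNash
            ((Steering.coordinationGame lo).augUtility (Steering.outcomePayment q)) x ∧
          (Steering.IsPure x ∨ ∀ y, Steering.IsPure y → ¬ Steering.IsNash
            ((Steering.coordinationGame lo).augUtility (Steering.outcomePayment q)) y)) ∧
        ∀ x, Steering.IsNash
            ((Steering.coordinationGame lo).augUtility (Steering.outcomePayment q)) x →
          (Steering.IsPure x ∨ ∀ y, Steering.IsPure y → ¬ Steering.IsNash
            ((Steering.coordinationGame lo).augUtility (Steering.outcomePayment q)) y) →
          1 < ∑ i, ((Steering.coordinationGame lo).expUtility i x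
            + 2 * Steering.outcomePayment q i x)) ∧
      (∀ R : ℕ → ℝ, (∀ T, 0 ≤ R T) →
        ∀ M : Steering.Mediator (Fin 2) (fun _ => Fin 2), M.IsOutcomeBased →
          ¬ M.Steers (Steering.coordinationGame lo) R d) ∧
      -- arbitrary payment functions of the mixed profile
      ∃ C : ℝ,
        (∃ alg : Steering.PlayerAlgorithm (Fin 2) (fun _ => Fin 2),
          ∀ (P : ℝ) (p : ℕ → Steering.Payment (Fin 2) (fun _ => Fin 2)),
            (∀ t, Steering.IsPayment P (p t)) →
              (∀ i T, (Steering.coordinationGame lo).regret P p (alg.play p) i T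
                ≤ C * Real.sqrt T) ∧
              ∀ t, 1 < ∑ i, ((Steering.coordinationGame lo).expUtility i (alg.play p t)
                + 2 * p t i (alg.play p t))) ∧
        (∀ R : ℕ → ℝ, (∀ T : ℕ, C * Real.sqrt T ≤ R T) →
          ∀ M : Steering.Mediator (Fin 2) (fun _ => Fin 2),
            ¬ M.Steers (Steering.coordinationGame lo) R d) :=
  ⟨Steering.uniformProfile, Steering.uniformProfile_apply, Steering.not_isPure_uniformProfile,
    Steering.isOptimalEquilibrium_iff hlo,
    fun q hq => ⟨Steering.exists_isPureIfPossibleNash lo q, fun _ hx hx' =>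
      one_lt_two.trans_le (Steering.IsPureIfPossibleNash.welfare_bound hlo hq ⟨hx, hx'⟩)⟩,
    fun _ hR _ hM => Steering.Mediator.not_steers_of_isOutcomeBased hlo hR hM,
    2 * (2 - lo),
    ⟨Steering.matchingAlgorithm lo, fun _ p hp =>
      ⟨Steering.regret_matchingAlgorithm_le hlo hp, fun t => by
        rw [Steering.play_matchingAlgorithm]
        exact one_lt_two.trans_le ((hp t).response_spec hlo _).2⟩⟩,
    fun _ hR M => M.not_steers_of_sqrt_le hlo hR⟩
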